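/- All vector spaces are over $\mathbb F_2$. For a matrix $\delta$, let $d(\delta)$ be the minimum distance of the binary linear code $\ker\delta$, i.e. the least Hamming weight of a nonzero vector in $\ker\delta$, with $d(\delta)=\infty$ if $\ker\delta=0$. Let $\delta_a,\delta_b,\delta_c,\delta_d$ be binary matrices, $\delta_\ell$ of size $r_\ell\times n_\ell$ (the parity check matrices of four classical codes), and put $d_\ell=d(\delta_\ell)$ and $d_\ell^T=d(\delta_\ell^T)$. The tensor product of the four complexes $\mathbb F_2^{n_\ell}\xrightarrow{\delta_\ell}\mathbb F_2^{r_\ell}$ is a length-5 chain complex $$C_0\xrightarrow{\partial_0}C_1\xrightarrow{\partial_1}C_2\xrightarrow{\partial_2}C_3\xrightarrow{\partial_3}C_4 ,$$ where $C_k$ is the direct sum of the tensor products of four spaces in which exactly $k$ factors are check spaces $\mathbb F_2^{r_\ell}$ and the other factors are bit spaces $\mathbb F_2^{n_\ell}$. The 4D hypergraph product code is the CSS code with one qubit for each standard basis vector of $C_2$ and with parity check matrices $H_X=\partial_2$ and $H_Z=\partial_1^T$; its stabilizer generators are the rows of $H=\mathrm{diag}(H_X,H_Z)$. Let $w_c$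 be the maximum weight of a stabilizer generator, and let $w_q$ be the maximum number of stabilizer generators (of both types together) acting on a single qubit. The energy $\epsilon(P)$ of a Pauli operator $P$ is the number of stabilizer generators that anticommute with $P$. A path from $P_0$ to $P_t$ is a sequence of Pauli operators $P_0,\dots,P_t$ in which consecutive operators differ on at most one qubit. The energy barrier $\Delta(P)$ is the minimum, over all paths from the identity to $P$, of the maximal energy along the path. Let $\Delta(L_Z)$ be the minimum of $\Delta(L)$ over the nontrivial $Z$ logical operators $L$ (the $Z$-type operators with bit string in $\ker H_X\setminus\operatorname{im}H_Z^T$), and $\Delta(L_X)$ the minimum of $\Delta(L)$ over the nontrivial $X$ logical operators $L$ (the $X$-type operators with bit string in $\ker H_Z\setminus\operatorname{im}H_X^T$); the minimum over the empty set is $\infty$. Suppose that $d_\ell\ge w_cw_q$ and $d_\ell^T\ge w_cw_q$ for all $\ell\in\{a,b,c,d\}$. Then: 1. if $d_\ell\ge 2$ for all $\ell$, then $\Delta(L_Z)\ge\min(d_a,d_b,d_c,d_d)$; 2. if $d_\ell^T\ge 2$ for all $\ell$, then $\Delta(L_X)\ge\min(d_a^T,d_b^T,d_c^T,d_d^T)$.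 (Both additional conditions hold automatically when $w_cw_q\ge 2$.) -/

import Mathlib

open scoped Matrix

namespace HGP

/-! ### Classical binary linear codes -/

/-- The minimum distance of the binary linear code with parity check matrix `δ`: the least Hamming
weight of a nonzero vector in the kernel of `δ`. It is `⊤` (infinite) if the code is zero. -/
noncomputable def distance {m n : ℕ} (δ : Matrix (Fin m) (Fin n) (ZMod 2)) : ℕ∞ :=
  ⨅ (x : Fin n → ZMod 2) (_ : δ *ᵥ x = 0) (_ : x ≠ 0), (hammingNorm x : ℕ∞)

/-! ### CSS codes, Pauli operators and energy barriers -/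

/-- A Pauli operator on the qubits `Q`, up to phase, in its binary representation:
the operator `X^x Z^z`. -/
@[ext] structure Pauli (Q : Type) where
  /-- the bit string of the `X` part -/
  x : Q → ZMod 2
  /-- the bit string of the `Z` part -/
  z : Q → ZMod 2

namespace Pauli

variable {Q : Type}

/-- The identity. -/
def one : Pauli Q := ⟨0, 0⟩

/-- The `Z`-type operator with bit string `z`. -/
def ofZ (z : Q → ZMod 2) : Pauli Q := ⟨0, z⟩

/-- The `X`-type operator with bit string `x`. -/
def ofX (x : Q → ZMod 2) : Pauli Q := ⟨x, 0⟩

/-- The number of qubits at which two Pauli operators differ. -/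
def dist [Fintype Q] (P P' : Pauli Q) : ℕ :=
  (Finset.univ.filter fun q => P.x q ≠ P'.x q ∨ P.z q ≠ P'.z q).card

end Pauli

/-- A CSS code with qubits `Q`, `X`-type generators `SX` and `Z`-type generators `SZ`, given by its
parity check matrices. -/
structure CSSCode (Q SX SZ : Type) [Fintype Q] where
  /-- the supports of the `X`-type generators -/
  HX : Matrix SX Q (ZMod 2)
  /-- the supports of the `Z`-type generators -/
  HZ : Matrix SZ Q (ZMod 2)
  /-- the generators commute -/
  comm : HX * HZᵀ = 0

namespace CSSCode

variable {Q SX SZ : Type} [Fintype Q] [Fintype SX] [Fintype SZ]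

/-- The parity check matrix `diag(HX, HZ)` of the code. Its rows are the stabilizer generators; the
first block of columns detects the `Z` parts of errors, the second one the `X` parts. -/
def parityCheck (C : CSSCode Q SX SZ) : Matrix (SX ⊕ SZ) (Q ⊕ Q) (ZMod 2) :=
  Matrix.fromBlocks C.HX 0 0 C.HZ

/-- The energy of a Pauli operator: the number of stabilizer generators anticommuting with it. -/
def energy (C : CSSCode Q SX SZ) (P : Pauli Q) : ℕ :=
  hammingNorm (C.parityCheck *ᵥ Sum.elim P.z P.x)

/-- `w_c`: the maximum weight of a stabilizer generator. -/
def maxCheckWeight (C : CSSCode Q SX SZ) : ℕ :=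
  Finset.univ.sup fun s : SX ⊕ SZ => hammingNorm (C.parityCheck s)

/-- `w_q`: the maximum number of stabilizer generators (of both types) acting on a single qubit. -/
def maxQubitDegree (C : CSSCode Q SX SZ) : ℕ :=
  Finset.univ.sup fun q : Q => (Finset.univ.filter fun s : SX ⊕ SZ =>
    C.parityCheck s (Sum.inl q) ≠ 0 ∨ C.parityCheck s (Sum.inr q) ≠ 0).card

/-- The bit strings of the nontrivial `Z` logical operators: `ker HX \ im HZᵀ`. -/
def zLogicals (C : CSSCode Q SX SZ) : Set (Q → ZMod 2) :=
  {z | C.HX *ᵥ z = 0 ∧ ¬ ∃ s : SZ → ZMod 2, C.HZᵀ *ᵥ s = z}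

/-- The bit strings of the nontrivial `X` logical operators: `ker HZ \ im HXᵀ`. -/
def xLogicals (C : CSSCode Q SX SZ) : Set (Q → ZMod 2) :=
  {x | C.HZ *ᵥ x = 0 ∧ ¬ ∃ s : SX → ZMod 2, C.HXᵀ *ᵥ s = x}

end CSSCode

/-- A path of Pauli operators from `P` to `P'`: consecutive operators differ at no more than one
qubit. -/
structure PauliPath {Q : Type} [Fintype Q] (P P' : Pauli Q) where
  /-- the number of steps -/
  len : ℕ
  /-- the operators along the path -/
  op : Fin (len + 1) → Pauli Q
  start_eq : op 0 = P
  end_eq : op (Fin.last len) = P'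
  local_step : ∀ i : Fin len, (op i.castSucc).dist (op i.succ) ≤ 1

namespace CSSCode

variable {Q SX SZ : Type} [Fintype Q] [Fintype SX] [Fintype SZ]

/-- The highest energy along a path. -/
def maxEnergy (C : CSSCode Q SX SZ) {P P' : Pauli Q} (r : PauliPath P P') : ℕ :=
  Finset.univ.sup fun i => C.energy (r.op i)

/-- The energy barrier of a Pauli operator: the minimum, over all paths from the identity, of the
highest energy along the path. -/
noncomputable def barrier (C : CSSCode Q SX SZ) (P : Pauli Q) : ℕ∞ :=
  ⨅ r : PauliPath Pauli.one P, (C.maxEnergy r : ℕ∞)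

/-- The energy barrier of the `Z` logical operators: the minimum of the energy barriers of the
nontrivial ones (`⊤` if there are none). -/
noncomputable def zBarrier (C : CSSCode Q SX SZ) : ℕ∞ :=
  ⨅ z ∈ C.zLogicals, C.barrier (Pauli.ofZ z)

/-- The energy barrier of the `X` logical operators: the minimum of the energy barriers of the
nontrivial ones (`⊤` if there are none). -/
noncomputable def xBarrier (C : CSSCode Q SX SZ) : ℕ∞ :=
  ⨅ x ∈ C.xLogicals, C.barrier (Pauli.ofX x)

end CSSCode

/-! ### The 4D hypergraph product

The tensor product over `𝔽₂` of the four complexes `𝔽₂^(n ℓ) → 𝔽₂^(r ℓ)` given by matrices `δ ℓ`. -/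

section Product

variable {n r : Fin 4 → ℕ}

/-- The standard basis of the whole product complex: a choice, for each of the four factors, of a
bit (`inl`, degree 0) or a check (`inr`, degree 1) of that factor. -/
abbrev Cube (n r : Fin 4 → ℕ) : Type := (l : Fin 4) → Fin (n l) ⊕ Fin (r l)

/-- The degree of a basis element: the number of factors in which it is a check. -/
def degree (s : Cube n r) : ℕ := (Finset.univ.filter fun l => (s l).isRight).card

/-- The standard basis of the component `C_k` of the product complex. -/
abbrev Cell (n r : Fin 4 → ℕ) (k : ℕ) : Type := {s : Cube n r // degree s = k}

/-- The Kronecker product of four matrices. -/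
def kron (M : (l : Fin 4) → Matrix (Fin (n l) ⊕ Fin (r l)) (Fin (n l) ⊕ Fin (r l)) (ZMod 2)) :
    Matrix (Cube n r) (Cube n r) (ZMod 2) :=
  Matrix.of fun t s => ∏ l, M l (t l) (s l)

/-- The boundary map of one factor, as an endomorphism of `𝔽₂^n ⊕ 𝔽₂^r`: it maps the bits to the
checks by `δ`, and it is zero on the checks. -/
def factorMap {m n : ℕ} (δ : Matrix (Fin m) (Fin n) (ZMod 2)) :
    Matrix (Fin n ⊕ Fin m) (Fin n ⊕ Fin m) (ZMod 2) :=
  Matrix.fromBlocks 0 0 δ 0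

/-- The boundary map of factor `l` tensored with the identity of the other factors. -/
def partialMap (δ : (l : Fin 4) → Matrix (Fin (r l)) (Fin (n l)) (ZMod 2)) (l : Fin 4) :
    Matrix (Cube n r) (Cube n r) (ZMod 2) :=
  kron (Function.update (fun _ => 1) l (factorMap (δ l)))

/-- The boundary map of the whole product complex (Leibniz rule, signs being irrelevant). -/
def totalMap (δ : (l : Fin 4) → Matrix (Fin (r l)) (Fin (n l)) (ZMod 2)) :
    Matrix (Cube n r) (Cube n r) (ZMod 2) :=
  ∑ l, partialMap δ l

/-- The map `∂_k : C_k → C_{k+1}` of the product complex `C_0 → C_1 → C_2 → C_3 → C_4`. For the block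
of `C_k` of a set of factors `S` and the block of `C_{k+1}` of `S ∪ {l}`, it is the Kronecker product
of `δ l` and of identity matrices; all other blocks are zero. -/
def boundary (δ : (l : Fin 4) → Matrix (Fin (r l)) (Fin (n l)) (ZMod 2)) (k : ℕ) :
    Matrix (Cell n r (k + 1)) (Cell n r k) (ZMod 2) :=
  (totalMap δ).submatrix Subtype.val Subtype.val

theorem kron_mul_kron
    (M N : (l : Fin 4) → Matrix (Fin (n l) ⊕ Fin (r l)) (Fin (n l) ⊕ Fin (r l)) (ZMod 2)) :
    kron M * kron N = kron (fun l => M l * N l) := by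
  ext t s
  simp only [kron, Matrix.mul_apply, Matrix.of_apply, ← Finset.prod_mul_distrib]
  exact (Fintype.prod_sum fun l j => M l (t l) j * N l j (s l)).symm

theorem factorMap_mul_self {m n : ℕ} (δ : Matrix (Fin m) (Fin n) (ZMod 2)) :
    factorMap δ * factorMap δ = 0 := by
  simp [factorMap, Matrix.fromBlocks_multiply]

theorem partialMap_mul_self (δ : (l : Fin 4) → Matrix (Fin (r l)) (Fin (n l)) (ZMod 2))
    (l : Fin 4) : partialMap δ l * partialMap δ l = 0 := by
  rw [partialMap, kron_mul_kron]
  ext t s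
  simp only [kron, Matrix.of_apply, Matrix.zero_apply]
  refine Finset.prod_eq_zero (Finset.mem_univ l) ?_
  simp [factorMap_mul_self]

theorem partialMap_comm (δ : (l : Fin 4) → Matrix (Fin (r l)) (Fin (n l)) (ZMod 2))
    (l m : Fin 4) : partialMap δ l * partialMap δ m = partialMap δ m * partialMap δ l := by
  rw [partialMap, partialMap, kron_mul_kron, kron_mul_kron]
  congr 1
  funext k
  by_cases hl : k = l
  · subst hl
    by_cases hm : k = m
    · subst hm; rfl
    · simp [Function.update_of_ne hm]
  · simp [Function.update_of_ne hl]

theorem totalMap_mul_self (δ : (l : Fin 4) → Matrix (Fin (r l)) (Fin (n l)) (ZMod 2)) :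
    totalMap δ * totalMap δ = 0 := by
  have h2 : ∀ A : Matrix (Cube n r) (Cube n r) (ZMod 2), A + A = 0 := by
    intro A; ext i j; exact CharTwo.add_self_eq_zero _
  simp only [totalMap, Fin.sum_univ_four, add_mul, mul_add, partialMap_mul_self]
  rw [partialMap_comm δ 1 0, partialMap_comm δ 2 0, partialMap_comm δ 3 0, partialMap_comm δ 2 1,
    partialMap_comm δ 3 1, partialMap_comm δ 3 2]
  abel_nf
  simp [two_smul, h2]

theorem degree_eq_of_partialMap_ne_zero
    (δ : (l : Fin 4) → Matrix (Fin (r l)) (Fin (n l)) (ZMod 2)) (l : Fin 4) (t s : Cube n r)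
    (h : partialMap δ l t s ≠ 0) : degree t = degree s + 1 := by
  have h' : ∀ k, Function.update
      (fun k => (1 : Matrix (Fin (n k) ⊕ Fin (r k)) (Fin (n k) ⊕ Fin (r k)) (ZMod 2)))
      l (factorMap (δ l)) k (t k) (s k) ≠ 0 := fun k => by
    rw [partialMap, kron, Matrix.of_apply, Finset.prod_ne_zero_iff] at h
    exact h k (Finset.mem_univ k)
  have hne : ∀ k, k ≠ l → t k = s k := fun k hk => by
    have := h' k
    rw [Function.update_of_ne hk] at this
    by_contra hts
    exact this (Matrix.one_apply_ne hts)
  have hl := h' l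
  rw [Function.update_self] at hl
  have hs : (s l).isRight = false ∧ (t l).isRight = true := by
    rcases ht : t l with a | a <;> rcases hs : s l with b | b <;>
      simp [ht, hs, factorMap] at hl ⊢
  have : (Finset.univ.filter fun k => (t k).isRight = true)
      = insert l (Finset.univ.filter fun k => (s k).isRight = true) := by
    ext k
    by_cases hk : k = l
    · subst hk; simp [hs.2]
    · simp [hk, hne k hk]
  rw [degree, degree, this, Finset.card_insert_of_notMem (by simp [hs.1])]

theorem totalMap_eq_zero (δ : (l : Fin 4) → Matrix (Fin (r l)) (Fin (n l)) (ZMod 2))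
    (t s : Cube n r) (h : degree t ≠ degree s + 1) : totalMap δ t s = 0 := by
  rw [totalMap, Matrix.sum_apply]
  refine Finset.sum_eq_zero fun l _ => ?_
  by_contra hl
  exact h (degree_eq_of_partialMap_ne_zero δ l t s hl)

theorem boundary_mul_boundary (δ : (l : Fin 4) → Matrix (Fin (r l)) (Fin (n l)) (ZMod 2))
    (k : ℕ) : boundary δ (k + 1) * boundary δ k = 0 := by
  ext t s
  have h : (totalMap δ * totalMap δ) t.1 s.1 = 0 := by rw [totalMap_mul_self]; rfl
  rw [Matrix.mul_apply] at h
  rw [Matrix.mul_apply, Matrix.zero_apply, ← h]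
  simp only [boundary, Matrix.submatrix_apply]
  rw [← Finset.sum_subtype (Finset.univ.filter fun u : Cube n r => degree u = k + 1) (by simp)
    (fun u => totalMap δ t.1 u * totalMap δ u s.1)]
  refine Finset.sum_subset (Finset.subset_univ _) fun u _ hu => ?_
  rw [totalMap_eq_zero δ u s.1, mul_zero]
  rw [s.2]
  simpa using hu

/-- The 4D hypergraph product code of four classical codes with parity check matrices `δ l`:
the qubits are the basis of `C_2`, `HX = ∂_2` and `HZ = ∂_1ᵀ`. -/
def code4D (δ : (l : Fin 4) → Matrix (Fin (r l)) (Fin (n l)) (ZMod 2)) :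
    CSSCode (Cell n r 2) (Cell n r 3) (Cell n r 1) where
  HX := boundary δ 2
  HZ := (boundary δ 1)ᵀ
  comm := by rw [Matrix.transpose_transpose]; exact boundary_mul_boundary δ 1

end Product

end HGP

/-! For each factor, a generalized inverse `h` of the boundary `f` gives P = 1 + fh + hf, which is
homotopic to the identity and satisfies Pf = 0. The product of the four maps P is then homotopic to
the identity of the total complex, so a cycle that is not a boundary has a nonzero image under it,
say at a basis element t (`exists_boundary_of_kron_retract_eq_zero`). As t has degree 2, exactly two
directions a, b of t are low and the other two are high.

Apply P in those other two directions only, and restrict to the plane through t in the directions a,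
b. By degree, the result is a matrix M supported on low × low positions, and a change of one qubit
changes at most one entry of M. Because Pf = 0, the boundary acts on the plane as f_a + f_b. Hence
every row of M that is not a codeword of b, and every column that is not a codeword of a, has its
own violated check: the energy bounds the number of bad lines (`badLines_slice_le`).

What remains is a statement on matrices (`eq_zero_of_path`). As long as there are fewer than d bad
lines, one-entry changes cannot make a good line nonzero: such a line has weight at least d, and the
lines crossing it at its support would have to be bad. A logical operator has no bad lines, so M = 0
at the end of the path, which contradicts the choice of t. The X case is the same argument for the
transposed complex. -/

namespace HGP

/-! ### Paths of matrices -/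

section Lines

variable {I J : Type} [Fintype I] [Fintype J]

open Classical in
/-- The number of rows of `M` outside `R`, plus the number of columns of `M` outside `K`. -/
noncomputable def badLines (R : Set (J → ZMod 2)) (K : Set (I → ZMod 2)) (M : Matrix I J (ZMod 2)) :
    ℕ :=
  (Finset.univ.filter fun i => M i ∉ R).card + (Finset.univ.filter fun j => Mᵀ j ∉ K).card

/-- The rows of `M` in `R` and the columns of `M` in `K` vanish. -/
def GoodLinesVanish (R : Set (J → ZMod 2)) (K : Set (I → ZMod 2)) (M : Matrix I J (ZMod 2)) :
    Prop :=
  (∀ i, M i ∈ R → M i = 0) ∧ ∀ j, Mᵀ j ∈ K → Mᵀ j = 0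

theorem badLines_transpose (R : Set (J → ZMod 2)) (K : Set (I → ZMod 2))
    (M : Matrix I J (ZMod 2)) : badLines K R Mᵀ = badLines R K M := by
  rw [badLines, badLines, Matrix.transpose_transpose, add_comm]

/-- Only row `i₀` can fail. If it becomes good and nonzero, it meets at least d columns, and all of
these except possibly column `j₀` were not touched and must be bad. The bound on bad lines leaves
one borderline case, d - 1 bad columns and no bad row, which is settled by looking at column `j₀`.
-/
theorem good_rows_vanish_of_update {d : ℕ} (hd : 2 ≤ d) {R : Set (J → ZMod 2)}
    {K : Set (I → ZMod 2)} (hR : ∀ x ∈ R, x ≠ 0 → d ≤ hammingNorm x)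
    (hK : ∀ x ∈ K, x ≠ 0 → d ≤ hammingNorm x) {M M' : Matrix I J (ZMod 2)}
    (hM : GoodLinesVanish R K M) (hM' : badLines R K M' < d) {i₀ : I} {j₀ : J}
    (h : ∀ i j, i ≠ i₀ ∨ j ≠ j₀ → M' i j = M i j) (i : I) (hi : M' i ∈ R) : M' i = 0 := by
  classical
  have hrow : ∀ i, i ≠ i₀ → M' i ∈ R → M' i = 0 := fun i hne hi => by
    have : M' i = M i := funext fun j => h i j (Or.inl hne)
    rw [this] at hi ⊢
    exact hM.1 i hi
  by_cases hii : i = i₀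
  swap
  · exact hrow i hii hi
  subst hii
  by_contra h0
  have hw := hR _ hi h0
  rw [badLines] at hM'
  set B := Finset.univ.filter fun j => M'ᵀ j ∉ K with hB
  have hsub : (Finset.univ.filter fun j => M' i j ≠ 0) ⊆ insert j₀ B := by
    intro j hj
    rw [Finset.mem_insert]
    by_cases hj₀ : j = j₀
    · exact Or.inl hj₀
    · refine Or.inr ?_
      rw [hB, Finset.mem_filter]
      refine ⟨Finset.mem_univ _, fun hjK => (Finset.mem_filter.1 hj).2 ?_⟩
      have hc : M'ᵀ j = Mᵀ j := funext fun k => h k j (Or.inr hj₀)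
      rw [hc] at hjK
      have := congrFun (hM.2 j hjK) i
      rw [h i j (Or.inr hj₀)]
      exact this
  have h1 : hammingNorm (M' i) ≤ B.card + 1 :=
    (Finset.card_le_card hsub).trans (Finset.card_insert_le _ _)
  -- Already d - 1 columns are bad, so a bad row would bring the count up to d.
  have hempty : ∀ k, M' k ∈ R := fun k => by
    by_contra hk
    have : 0 < (Finset.univ.filter fun i => M' i ∉ R).card :=
      Finset.card_pos.2 ⟨k, by simpa using hk⟩
    omega
  -- Now all other rows vanish, so a column through the support of row `i` has weight one. Since `2
  -- ≤ d`, it is bad; this includes column `j₀`.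
  have hsub' : (Finset.univ.filter fun j => M' i j ≠ 0) ⊆ B := by
    intro j hj
    have hj' := (Finset.mem_filter.1 hj).2
    rw [hB, Finset.mem_filter]
    refine ⟨Finset.mem_univ _, fun hjK => ?_⟩
    have hle : hammingNorm (M'ᵀ j) ≤ 1 := by
      refine Finset.card_le_one.2 fun k hk k' hk' => ?_
      have key : ∀ k, k ∈ (Finset.univ.filter fun k => M'ᵀ j k ≠ 0) → k = i := fun k hk => by
        by_contra hne
        exact (Finset.mem_filter.1 hk).2 (congrFun (hrow k hne (hempty k)) j)
      rw [key k hk, key k' hk']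
    have := hK _ hjK fun h0 => hj' (congrFun h0 i)
    omega
  have h2 : hammingNorm (M' i) ≤ B.card := Finset.card_le_card hsub'
  omega

theorem GoodLinesVanish.update {d : ℕ} (hd : 2 ≤ d) {R : Set (J → ZMod 2)}
    {K : Set (I → ZMod 2)} (hR : ∀ x ∈ R, x ≠ 0 → d ≤ hammingNorm x)
    (hK : ∀ x ∈ K, x ≠ 0 → d ≤ hammingNorm x) {M M' : Matrix I J (ZMod 2)}
    (hM : GoodLinesVanish R K M) (hM' : badLines R K M' < d) {i₀ : I} {j₀ : J}
    (h : ∀ i j, i ≠ i₀ ∨ j ≠ j₀ → M' i j = M i j) : GoodLinesVanish R K M' :=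
  ⟨good_rows_vanish_of_update hd hR hK hM hM' h,
    good_rows_vanish_of_update (M := Mᵀ) (M' := M'ᵀ) hd hK hR ⟨hM.2, hM.1⟩
      ((badLines_transpose R K M').trans_lt hM') fun j i hji => h i j hji.symm⟩

/-- A path of matrices with few bad lines that changes one entry at a time and starts at zero does
not reach a nonzero matrix all of whose rows are good. -/
theorem eq_zero_of_path {d : ℕ} (hd : 2 ≤ d) {R : Set (J → ZMod 2)}
    {K : Set (I → ZMod 2)} (hR : ∀ x ∈ R, x ≠ 0 → d ≤ hammingNorm x)
    (hK : ∀ x ∈ K, x ≠ 0 → d ≤ hammingNorm x) {N : ℕ} (M : Fin (N + 1) → Matrix I J (ZMod 2))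
    (h0 : M 0 = 0) (hbad : ∀ k, badLines R K (M k) < d)
    (hstep : ∀ k : Fin N, ∃ i₀ j₀, ∀ i j, i ≠ i₀ ∨ j ≠ j₀ → M k.succ i j = M k.castSucc i j)
    (hlast : ∀ i, M (Fin.last N) i ∈ R) : M (Fin.last N) = 0 := by
  have key : ∀ k, GoodLinesVanish R K (M k) := by
    intro k
    induction k using Fin.induction with
    | zero => rw [h0]; exact ⟨fun _ _ => rfl, fun _ _ => rfl⟩
    | succ k ih =>
      obtain ⟨i₀, j₀, h⟩ := hstep k
      exact ih.update hd hR hK (hbad _) h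
  funext i
  exact (key _).1 i (hlast i)

end Lines

/-! ### Homotopy retracts of the factors -/

/-- Over a field, `δ` has a linear section over its image, and this section extends to the whole
target. -/
theorem exists_mul_mul_self {m n : ℕ} (δ : Matrix (Fin m) (Fin n) (ZMod 2)) :
    ∃ g : Matrix (Fin n) (Fin m) (ZMod 2), δ * g * δ = δ := by
  obtain ⟨s, hs⟩ := (Matrix.toLin' δ).rangeRestrict.exists_rightInverse_of_surjective
    (LinearMap.range_rangeRestrict _)
  obtain ⟨g, hg⟩ := LinearMap.exists_extend s
  refine ⟨LinearMap.toMatrix' g, Matrix.toLin'.injective ?_⟩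
  rw [Matrix.toLin'_mul, Matrix.toLin'_mul, Matrix.toLin'_toMatrix']
  refine LinearMap.ext fun v => ?_
  have h1 := LinearMap.congr_fun hg ((Matrix.toLin' δ).rangeRestrict v)
  have h2 := LinearMap.congr_fun hs ((Matrix.toLin' δ).rangeRestrict v)
  have h3 : g (Matrix.toLin' δ v) = s ((Matrix.toLin' δ).rangeRestrict v) := h1
  change Matrix.toLin' δ (g (Matrix.toLin' δ v)) = _
  rw [h3]
  exact congrArg Subtype.val h2

/-- `f` raises a grading of the basis by `Bool`, and `h` is a generalized inverse of `f` that lowers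
it. -/
structure GradedInverse {I : Type} [Fintype I] (f h : Matrix I I (ZMod 2)) (ε : I → Bool) :
    Prop where
  raise : ∀ i j, f i j ≠ 0 → ε i = true ∧ ε j = false
  lower : ∀ i j, h i j ≠ 0 → ε i = false ∧ ε j = true
  mul_mul_self : f * h * f = f

/-- The endomorphism homotopic to the identity by the homotopy `h`. -/
def retract {I : Type} [Fintype I] [DecidableEq I] (f h : Matrix I I (ZMod 2)) :
    Matrix I I (ZMod 2) :=
  1 + (f * h + h * f)

/-- Transposition reverses the complex, so low and high are exchanged. This carries the argument
over to X operators. -/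
theorem GradedInverse.transpose {I : Type} [Fintype I] {f h : Matrix I I (ZMod 2)} {ε : I → Bool}
    (H : GradedInverse f h ε) : GradedInverse fᵀ hᵀ (fun i => !ε i) where
  raise i j hij := by simpa [and_comm] using H.raise j i hij
  lower i j hij := by simpa [and_comm] using H.lower j i hij
  mul_mul_self := by
    rw [← Matrix.transpose_mul, ← Matrix.transpose_mul, ← Matrix.mul_assoc, H.mul_mul_self]

theorem GradedInverse.mul_self {I : Type} [Fintype I] {f h : Matrix I I (ZMod 2)} {ε : I → Bool}
    (H : GradedInverse f h ε) : f * f = 0 := by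
  ext i j
  rw [Matrix.mul_apply, Matrix.zero_apply]
  refine Finset.sum_eq_zero fun k _ => ?_
  by_contra hne
  have h1 := H.raise i k (left_ne_zero_of_mul hne)
  have h2 := H.raise k j (right_ne_zero_of_mul hne)
  simp [h1.2] at h2

namespace GradedInverse

variable {I : Type} [Fintype I] [DecidableEq I] {f h : Matrix I I (ZMod 2)} {ε : I → Bool}

/-- The product expands to f + fhf + hff = f + f. -/
theorem retract_mul (H : GradedInverse f h ε) : retract f h * f = 0 := by
  rw [retract, add_mul, add_mul, H.mul_mul_self, one_mul, Matrix.mul_assoc h, H.mul_self, mul_zero,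
    add_zero]
  ext i j
  exact CharTwo.add_self_eq_zero _

theorem retract_graded (H : GradedInverse f h ε) (i j : I) (hij : retract f h i j ≠ 0) :
    ε i = ε j := by
  contrapose! hij
  have h1 : i ≠ j := fun h => hij (congrArg ε h)
  have h2 : (f * h) i j = 0 := by
    rw [Matrix.mul_apply]
    refine Finset.sum_eq_zero fun k _ => ?_
    by_contra hne
    exact hij ((H.raise i k (left_ne_zero_of_mul hne)).1.trans
      (H.lower k j (right_ne_zero_of_mul hne)).2.symm)
  have h3 : (h * f) i j = 0 := by
    rw [Matrix.mul_apply]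
    refine Finset.sum_eq_zero fun k _ => ?_
    by_contra hne
    exact hij ((H.lower i k (left_ne_zero_of_mul hne)).1.trans
      (H.raise k j (right_ne_zero_of_mul hne)).2.symm)
  simp [retract, Matrix.one_apply_ne h1, h2, h3]

end GradedInverse

theorem exists_gradedInverse_factorMap {m n : ℕ} (δ : Matrix (Fin m) (Fin n) (ZMod 2)) :
    ∃ h, GradedInverse (factorMap δ) h Sum.isRight := by
  obtain ⟨g, hg⟩ := exists_mul_mul_self δ
  refine ⟨Matrix.fromBlocks 0 g 0 0, ?_, ?_, ?_⟩
  · rintro (i | i) (j | j) <;> simp [factorMap]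
  · rintro (i | i) (j | j) <;> simp
  · simp [factorMap, Matrix.fromBlocks_multiply, hg]

/-! ### Kronecker products -/

section Kron

variable {n r : Fin 4 → ℕ}

/-- A family of endomorphisms of the factors. -/
abbrev FactorMaps (n r : Fin 4 → ℕ) : Type :=
  (l : Fin 4) → Matrix (Fin (n l) ⊕ Fin (r l)) (Fin (n l) ⊕ Fin (r l)) (ZMod 2)

/-- An endomorphism of the factor `l`, tensored with the identity of the other factors. -/
def onFactor (l : Fin 4) (A : Matrix (Fin (n l) ⊕ Fin (r l)) (Fin (n l) ⊕ Fin (r l)) (ZMod 2)) :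
    Matrix (Cube n r) (Cube n r) (ZMod 2) :=
  kron (Function.update (fun _ => 1) l A)

/-- The sum of endomorphisms of the factors, each tensored with the identities of the others. -/
def kronSum (f : FactorMaps n r) : Matrix (Cube n r) (Cube n r) (ZMod 2) :=
  ∑ l, onFactor l (f l)

theorem kron_transpose (M : FactorMaps n r) : (kron M)ᵀ = kron fun l => (M l)ᵀ := rfl

theorem kron_one : kron (fun _ => 1 : FactorMaps n r) = 1 := by
  ext t s
  rw [kron, Matrix.of_apply]
  by_cases h : t = s
  · subst h; simp
  · obtain ⟨l, hl⟩ := Function.ne_iff.1 h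
    rw [Matrix.one_apply_ne h]
    exact Finset.prod_eq_zero (Finset.mem_univ l) (Matrix.one_apply_ne hl)

theorem kron_eq_zero (M : FactorMaps n r) (l : Fin 4) (h : M l = 0) : kron M = 0 := by
  ext t s
  rw [kron, Matrix.of_apply]
  exact Finset.prod_eq_zero (Finset.mem_univ l) (congrFun (congrFun h (t l)) (s l))

theorem kron_comm (M N : FactorMaps n r) (h : ∀ l, M l * N l = N l * M l) :
    kron M * kron N = kron N * kron M := by
  rw [kron_mul_kron, kron_mul_kron]
  exact congrArg kron (funext h)

theorem factor_ne_zero_of_kron_ne_zero {M : FactorMaps n r} {t s : Cube n r} (h : kron M t s ≠ 0)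
    (l : Fin 4) : M l (t l) (s l) ≠ 0 := by
  rw [kron, Matrix.of_apply, Finset.prod_ne_zero_iff] at h
  exact h l (Finset.mem_univ l)

theorem onFactor_apply (l : Fin 4)
    (A : Matrix (Fin (n l) ⊕ Fin (r l)) (Fin (n l) ⊕ Fin (r l)) (ZMod 2)) (t s : Cube n r) :
    onFactor l A t s = A (t l) (s l) * ∏ k ∈ Finset.univ.erase l,
      (1 : Matrix (Fin (n k) ⊕ Fin (r k)) (Fin (n k) ⊕ Fin (r k)) (ZMod 2)) (t k) (s k) := by
  rw [onFactor, kron, Matrix.of_apply, ← Finset.mul_prod_erase _ _ (Finset.mem_univ l),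
    Function.update_self]
  congr 1
  refine Finset.prod_congr rfl fun k hk => ?_
  rw [Function.update_of_ne (Finset.ne_of_mem_erase hk)]

theorem onFactor_one (l : Fin 4) : onFactor (n := n) (r := r) l 1 = 1 := by
  rw [onFactor, ← kron_one]
  congr 1
  funext k
  by_cases hk : k = l
  · subst hk; simp
  · simp [hk]

theorem onFactor_add (l : Fin 4)
    (A B : Matrix (Fin (n l) ⊕ Fin (r l)) (Fin (n l) ⊕ Fin (r l)) (ZMod 2)) :
    onFactor l (A + B) = onFactor l A + onFactor l B := by
  ext t s
  simp only [onFactor_apply, Matrix.add_apply, add_mul]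

theorem onFactor_mul (l : Fin 4)
    (A B : Matrix (Fin (n l) ⊕ Fin (r l)) (Fin (n l) ⊕ Fin (r l)) (ZMod 2)) :
    onFactor l A * onFactor l B = onFactor l (A * B) := by
  rw [onFactor, onFactor, onFactor, kron_mul_kron]
  congr 1
  funext k
  by_cases hk : k = l
  · subst hk; simp
  · simp [hk]

theorem onFactor_comm {l m : Fin 4} (hlm : l ≠ m)
    (A : Matrix (Fin (n l) ⊕ Fin (r l)) (Fin (n l) ⊕ Fin (r l)) (ZMod 2))
    (B : Matrix (Fin (n m) ⊕ Fin (r m)) (Fin (n m) ⊕ Fin (r m)) (ZMod 2)) :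
    onFactor l A * onFactor m B = onFactor m B * onFactor l A := by
  refine kron_comm _ _ fun k => ?_
  by_cases hk : k = l
  · subst hk; simp [Function.update_of_ne hlm]
  · simp [Function.update_of_ne hk]

theorem onFactor_mulVec_apply (l : Fin 4)
    (A : Matrix (Fin (n l) ⊕ Fin (r l)) (Fin (n l) ⊕ Fin (r l)) (ZMod 2)) (y : Cube n r → ZMod 2)
    (t : Cube n r) : (onFactor l A *ᵥ y) t = ∑ k, A (t l) k * y (Function.update t l k) := by
  have hinj : Function.Injective fun k => Function.update t l k := Function.update_injective t l
  rw [Matrix.mulVec, dotProduct, ← Finset.sum_subset (Finset.subset_univ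
    (Finset.univ.map ⟨fun k => Function.update t l k, hinj⟩)), Finset.sum_map]
  · refine Finset.sum_congr rfl fun k _ => ?_
    rw [onFactor_apply]
    simp only [Function.Embedding.coeFn_mk, Function.update_self]
    rw [Finset.prod_eq_one, mul_one]
    intro m hm
    have : Function.update t l k m = t m := Function.update_of_ne (Finset.ne_of_mem_erase hm) _ _
    exact (congrArg _ this).trans (Matrix.one_apply_eq _)
  · intro s _ hs
    by_contra hne
    have h1 := factor_ne_zero_of_kron_ne_zero (left_ne_zero_of_mul hne)
    refine hs (Finset.mem_map.2 ⟨s l, Finset.mem_univ _, ?_⟩)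
    funext m
    by_cases hm : m = l
    · subst hm; simp
    · have := h1 m
      rw [Function.update_of_ne hm] at this
      simp only [Function.Embedding.coeFn_mk, Function.update_of_ne hm]
      by_contra hts
      exact this (Matrix.one_apply_ne hts)

theorem onFactor_mul_eq_kron (M : FactorMaps n r) :
    onFactor 3 (M 3) * (onFactor 2 (M 2) * (onFactor 1 (M 1) * onFactor 0 (M 0))) = kron M := by
  simp only [onFactor, kron_mul_kron]
  congr 1
  funext k
  fin_cases k <;> simp [Function.update]

/-- Boundaries of the factors other than `l` commute with the homotopy and cancel in characteristic
2. -/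
theorem kronSum_homotopy (f h : FactorMaps n r) (l : Fin 4) :
    kronSum f * onFactor l (h l) + onFactor l (h l) * kronSum f
      = 1 + onFactor l (retract (f l) (h l)) := by
  have h2 : ∀ A : Matrix (Cube n r) (Cube n r) (ZMod 2), A + A = 0 := by
    intro A; ext i j; exact CharTwo.add_self_eq_zero _
  rw [retract, onFactor_add, onFactor_one, ← add_assoc, h2, zero_add, kronSum, Finset.sum_mul,
    Finset.mul_sum, ← Finset.sum_add_distrib, Finset.sum_eq_single l]
  · rw [onFactor_mul, onFactor_mul, onFactor_add]
  · intro m _ hm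
    rw [onFactor_comm hm, h2]
  · simp

/-- A cycle is homologous to its image under the product of the retracts of the factors. -/
theorem exists_boundary_of_kron_retract_eq_zero {f h : FactorMaps n r}
    (hf : kronSum f * kronSum f = 0) {x : Cube n r → ZMod 2} (hx : kronSum f *ᵥ x = 0)
    (h0 : kron (fun l => retract (f l) (h l)) *ᵥ x = 0) : ∃ w, x = kronSum f *ᵥ w := by
  -- Retracting one factor keeps a cycle a cycle and changes it by a boundary; four such steps give
  -- the full product.
  have step : ∀ l (y : Cube n r → ZMod 2), kronSum f *ᵥ y = 0 →
      kronSum f *ᵥ (onFactor l (retract (f l) (h l)) *ᵥ y) = 0 ∧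
        ∃ w, y = onFactor l (retract (f l) (h l)) *ᵥ y + kronSum f *ᵥ w := by
    intro l y hy
    have key := congrArg (fun A => A *ᵥ y) (kronSum_homotopy f h l)
    simp only [Matrix.add_mulVec, ← Matrix.mulVec_mulVec, hy, Matrix.mulVec_zero, add_zero,
      Matrix.one_mulVec] at key
    have hy2 : ∀ v : Cube n r → ZMod 2, v + v = 0 := fun v =>
      funext fun i => CharTwo.add_self_eq_zero _
    constructor
    · have := congrArg (fun v => kronSum f *ᵥ v) key
      simpa [Matrix.mulVec_add, Matrix.mulVec_mulVec, ← Matrix.mul_assoc, hf, hy] using this.symm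
    · refine ⟨onFactor l (h l) *ᵥ y, ?_⟩
      rw [key, add_left_comm, hy2, add_zero]
  obtain ⟨h1, w1, e1⟩ := step 0 x hx
  obtain ⟨h2, w2, e2⟩ := step 1 _ h1
  obtain ⟨h3, w3, e3⟩ := step 2 _ h2
  obtain ⟨-, w4, e4⟩ := step 3 _ h3
  refine ⟨w4 + w3 + w2 + w1, ?_⟩
  rw [← onFactor_mul_eq_kron] at h0
  simp only [← Matrix.mulVec_mulVec] at h0
  rw [h0, zero_add] at e4
  rw [Matrix.mulVec_add, Matrix.mulVec_add, Matrix.mulVec_add, ← e4, ← e3, ← e2, ← e1]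

/-- Keep the factors `a` and `b`, and apply the retracts of the other factors. -/
def retractOff (f h : FactorMaps n r) (a b : Fin 4) : FactorMaps n r := fun l =>
  if l = a ∨ l = b then 1 else retract (f l) (h l)

/-- The boundaries of the retracted factors die by `retract_mul`; those of `a` and `b` meet
identities and commute. The total boundary thus becomes two-dimensional. -/
theorem kron_retractOff_mul_kronSum {f h : FactorMaps n r}
    {ε : (l : Fin 4) → Fin (n l) ⊕ Fin (r l) → Bool} (H : ∀ l, GradedInverse (f l) (h l) (ε l))
    {a b : Fin 4} (hab : a ≠ b) :
    kron (retractOff f h a b) * kronSum f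
      = (onFactor a (f a) + onFactor b (f b)) * kron (retractOff f h a b) := by
  have hcomm : ∀ l, l = a ∨ l = b → kron (retractOff f h a b) * onFactor l (f l)
      = onFactor l (f l) * kron (retractOff f h a b) := fun l hl => by
    refine kron_comm _ _ fun k => ?_
    by_cases hk : k = l
    · subst hk; simp [retractOff, hl]
    · simp [Function.update_of_ne hk]
  rw [kronSum, Finset.mul_sum, ← Finset.sum_subset (Finset.subset_univ {a, b}),
    Finset.sum_pair hab, hcomm a (Or.inl rfl), hcomm b (Or.inr rfl), add_mul]
  intro l _ hl
  rw [Finset.mem_insert, Finset.mem_singleton] at hl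
  rw [onFactor, kron_mul_kron]
  refine kron_eq_zero _ l ?_
  rw [retractOff, if_neg hl, Function.update_self, (H l).retract_mul]

end Kron

/-! ### Two-dimensional slices -/

section Slice

variable {n r : Fin 4 → ℕ}

/-- The degree of a basis element of the product, for given gradings of the factors. -/
def gradedDegree (ε : (l : Fin 4) → Fin (n l) ⊕ Fin (r l) → Bool) (s : Cube n r) : ℕ :=
  (Finset.univ.filter fun l => ε l (s l)).card

/-- The restriction of `y` to the slice through `t` in the directions `a` and `b`. -/
def slice (t : Cube n r) (a b : Fin 4) (y : Cube n r → ZMod 2) :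
    Matrix (Fin (n a) ⊕ Fin (r a)) (Fin (n b) ⊕ Fin (r b)) (ZMod 2) :=
  Matrix.of fun i j => y (Function.update (Function.update t a i) b j)

/-- The codewords of degree zero. -/
def lowKernel {I : Type} [Fintype I] (f : Matrix I I (ZMod 2)) (ε : I → Bool) :
    Set (I → ZMod 2) :=
  {x | (∀ i, ε i = true → x i = 0) ∧ f *ᵥ x = 0}

variable {f h : FactorMaps n r} {ε : (l : Fin 4) → Fin (n l) ⊕ Fin (r l) → Bool} {a b : Fin 4}
  {t : Cube n r}

theorem slice_transpose (hab : a ≠ b) (y : Cube n r → ZMod 2) :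
    (slice t a b y)ᵀ = slice t b a y := by
  ext i j
  simp [slice, Function.update_comm hab]

theorem retractOff_symm : retractOff f h a b = retractOff f h b a := by
  funext l
  simp only [retractOff, or_comm]

theorem exists_of_kron_mulVec_ne_zero {M : FactorMaps n r} {y : Cube n r → ZMod 2} {u : Cube n r}
    (hu : (kron M *ᵥ y) u ≠ 0) : ∃ v, y v ≠ 0 ∧ ∀ l, M l (u l) (v l) ≠ 0 := by
  obtain ⟨v, -, hv⟩ := Finset.exists_ne_zero_of_sum_ne_zero hu
  exact ⟨v, right_ne_zero_of_mul hv, factor_ne_zero_of_kron_ne_zero (left_ne_zero_of_mul hv)⟩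

theorem eq_of_retractOff_ne_zero {l : Fin 4} (hl : l = a ∨ l = b) {i j : Fin (n l) ⊕ Fin (r l)}
    (hij : retractOff f h a b l i j ≠ 0) : i = j := by
  rw [retractOff, if_pos hl] at hij
  by_contra hne
  exact hij (Matrix.one_apply_ne hne)

theorem retractOff_graded (H : ∀ l, GradedInverse (f l) (h l) (ε l)) {l : Fin 4}
    {i j : Fin (n l) ⊕ Fin (r l)} (hij : retractOff f h a b l i j ≠ 0) : ε l i = ε l j := by
  by_cases hl : l = a ∨ l = b
  · rw [eq_of_retractOff_ne_zero hl hij]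
  · rw [retractOff, if_neg hl] at hij
    exact (H l).retract_graded i j hij

/-- The retracts preserve degree, and the two directions outside the plane already use up the total
degree 2. -/
theorem low_of_slice_ne_zero (H : ∀ l, GradedInverse (f l) (h l) (ε l)) (hab : a ≠ b)
    (ht : ∀ l, l ≠ a → l ≠ b → ε l (t l) = true) {z : Cube n r → ZMod 2}
    (hz : ∀ s, z s ≠ 0 → gradedDegree ε s = 2) {i : Fin (n a) ⊕ Fin (r a)}
    {j : Fin (n b) ⊕ Fin (r b)} (hij : slice t a b (kron (retractOff f h a b) *ᵥ z) i j ≠ 0) :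
    ε a i = false ∧ ε b j = false := by
  obtain ⟨v, hv, hN⟩ := exists_of_kron_mulVec_ne_zero hij
  set u := Function.update (Function.update t a i) b j with hu
  have hua : u a = i := by simp [hu, hab]
  have hub : u b = j := by simp [hu]
  have huε : gradedDegree ε u = 2 := by
    rw [← hz v hv, gradedDegree, gradedDegree]
    simp only [fun l => retractOff_graded H (hN l)]
  rw [gradedDegree] at huε
  have hsub : ({a, b} : Finset (Fin 4))ᶜ ⊆ Finset.univ.filter fun l => ε l (u l) = true := by
    intro l hl
    simp only [Finset.mem_compl, Finset.mem_insert, Finset.mem_singleton, not_or] at hl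
    have : u l = t l := by
      rw [hu, Function.update_of_ne hl.2, Function.update_of_ne hl.1]
    simpa [this] using ht l hl.1 hl.2
  have heq := Finset.eq_of_subset_of_card_le hsub (by
    rw [huε, Finset.card_compl, Finset.card_pair hab]; simp)
  have hmem : ∀ l, l = a ∨ l = b → ε l (u l) = false := fun l hl => by
    have h1 : l ∉ Finset.univ.filter fun l => ε l (u l) = true := by
      rw [← heq]; simpa [or_iff_not_imp_left] using hl
    simpa using h1
  exact ⟨hua ▸ hmem a (Or.inl rfl), hub ▸ hmem b (Or.inr rfl)⟩

/-- The row is supported in low degree, so it is bad only because `f b` does not kill it. The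
resulting nonzero value of the boundary in the plane comes from a violated check with the same
coordinates in the directions `a` and `b`, where nothing was retracted. -/
theorem exists_syndrome_of_bad_row (H : ∀ l, GradedInverse (f l) (h l) (ε l)) (hab : a ≠ b)
    (ht : ∀ l, l ≠ a → l ≠ b → ε l (t l) = true) {z : Cube n r → ZMod 2}
    (hz : ∀ s, z s ≠ 0 → gradedDegree ε s = 2) (i : Fin (n a) ⊕ Fin (r a))
    (hi : slice t a b (kron (retractOff f h a b) *ᵥ z) i ∉ lowKernel (f b) (ε b)) :
    ∃ v, (kronSum f *ᵥ z) v ≠ 0 ∧ v a = i ∧ ε a (v a) = false ∧ ε b (v b) = true := by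
  set y := kron (retractOff f h a b) *ᵥ z with hy
  have hk : f b *ᵥ slice t a b y i ≠ 0 := fun h0 => hi ⟨fun j hj => by
    by_contra hne
    have := (low_of_slice_ne_zero H hab ht hz hne).2
    simp [hj] at this, h0⟩
  obtain ⟨k, hk⟩ := Function.ne_iff.1 hk
  obtain ⟨j, -, hj⟩ : ∃ j ∈ Finset.univ, f b k j * slice t a b y i j ≠ 0 :=
    Finset.exists_ne_zero_of_sum_ne_zero hk
  have hia := (low_of_slice_ne_zero H hab ht hz (right_ne_zero_of_mul hj)).1
  have hkb := ((H b).raise k j (left_ne_zero_of_mul hj)).1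
  set u := Function.update (Function.update t a i) b k with hu
  have hua : u a = i := by simp [hu, hab]
  have hub : u b = k := by simp [hu]
  have h1 : (onFactor b (f b) *ᵥ y) u = (f b *ᵥ slice t a b y i) k := by
    rw [onFactor_mulVec_apply, hub]
    simp only [hu, Function.update_idem]
    rfl
  -- The position `u` is low in direction `a`, while `f a` takes values in high positions, so the
  -- two parts of the boundary cannot cancel at `u`.
  have h2 : (onFactor a (f a) *ᵥ y) u = 0 := by
    rw [onFactor_mulVec_apply, hua]
    refine Finset.sum_eq_zero fun m _ => ?_
    by_contra hne
    have := ((H a).raise i m (left_ne_zero_of_mul hne)).1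
    simp [hia] at this
  have h3 : (kron (retractOff f h a b) *ᵥ (kronSum f *ᵥ z)) u ≠ 0 := by
    rw [Matrix.mulVec_mulVec, kron_retractOff_mul_kronSum H hab, ← Matrix.mulVec_mulVec,
      Matrix.add_mulVec, Pi.add_apply, ← hy, h1, h2, zero_add]
    exact hk
  obtain ⟨v, hv, hN⟩ := exists_of_kron_mulVec_ne_zero h3
  have hva : v a = i := (eq_of_retractOff_ne_zero (Or.inl rfl) (hN a)).symm.trans hua
  have hvb : v b = k := (eq_of_retractOff_ne_zero (Or.inr rfl) (hN b)).symm.trans hub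
  exact ⟨v, hv, hva, hva ▸ hia, hvb ▸ hkb⟩

/-- Witnesses of bad rows are high in direction `b` and those of bad columns are low there, so no
check is counted twice; the coordinate in direction `a`, respectively `b`, recovers the line. -/
theorem badLines_slice_le (H : ∀ l, GradedInverse (f l) (h l) (ε l)) (hab : a ≠ b)
    (ht : ∀ l, l ≠ a → l ≠ b → ε l (t l) = true) {z : Cube n r → ZMod 2}
    (hz : ∀ s, z s ≠ 0 → gradedDegree ε s = 2) :
    badLines (lowKernel (f b) (ε b)) (lowKernel (f a) (ε a))
      (slice t a b (kron (retractOff f h a b) *ᵥ z)) ≤ hammingNorm (kronSum f *ᵥ z) := by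
  classical
  set S := Finset.univ.filter fun v => (kronSum f *ᵥ z) v ≠ 0 with hS
  have hcard : hammingNorm (kronSum f *ᵥ z)
      = (S.filter fun v => ε b (v b) = true).card + (S.filter fun v => ¬ ε b (v b) = true).card :=
    (Finset.card_filter_add_card_filter_not _).symm
  rw [badLines, hcard]
  refine Nat.add_le_add (le_trans (Finset.card_le_card ?_) (Finset.card_image_le
    (f := fun v : Cube n r => v a))) (le_trans (Finset.card_le_card ?_) (Finset.card_image_le
    (f := fun v : Cube n r => v b)))
  · intro i hi
    obtain ⟨v, hv, hva, -, hvb⟩ :=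
      exists_syndrome_of_bad_row H hab ht hz i (Finset.mem_filter.1 hi).2
    exact Finset.mem_image.2 ⟨v, by simp [hS, hv, hvb], hva⟩
  · intro j hj
    have hj' := (Finset.mem_filter.1 hj).2
    rw [slice_transpose hab, retractOff_symm] at hj'
    obtain ⟨v, hv, hvb, hvb', -⟩ :=
      exists_syndrome_of_bad_row H hab.symm (fun l h1 h2 => ht l h2 h1) hz j hj'
    exact Finset.mem_image.2 ⟨v, by simp [hS, hv, hvb'], hvb⟩

/-- Retracting spreads the coefficient at `q` only in directions transverse to the plane, so it
reaches a single entry of the slice. -/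
theorem slice_update {z z' : Cube n r → ZMod 2} (q : Cube n r) (hq : ∀ s, s ≠ q → z' s = z s)
    (hab : a ≠ b) (i : Fin (n a) ⊕ Fin (r a)) (j : Fin (n b) ⊕ Fin (r b))
    (hij : i ≠ q a ∨ j ≠ q b) :
    slice t a b (kron (retractOff f h a b) *ᵥ z') i j
      = slice t a b (kron (retractOff f h a b) *ᵥ z) i j := by
  refine Finset.sum_congr rfl fun s _ => ?_
  by_cases hs : s = q
  · subst hs
    have h0 : kron (retractOff f h a b) (Function.update (Function.update t a i) b j) s = 0 := by
      by_contra hne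
      have hN := factor_ne_zero_of_kron_ne_zero hne
      have h1 := eq_of_retractOff_ne_zero (Or.inl rfl) (hN a)
      have h2 := eq_of_retractOff_ne_zero (Or.inr rfl) (hN b)
      rw [Function.update_of_ne hab, Function.update_self] at h1
      rw [Function.update_self] at h2
      exact hij.elim (fun h => h h1) fun h => h h2
    dsimp only
    rw [h0, zero_mul, zero_mul]
  · dsimp only
    rw [hq s hs]

/-- The two retracts still missing act within the plane, so the value at `t` is a combination of
entries of the slice. -/
theorem kron_retract_eq_zero_of_slice_eq_zero (hab : a ≠ b) {z : Cube n r → ZMod 2}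
    (h0 : slice t a b (kron (retractOff f h a b) *ᵥ z) = 0) :
    (kron (fun l => retract (f l) (h l)) *ᵥ z) t = 0 := by
  have hfac : kron (fun l => retract (f l) (h l))
      = kron (fun l => if l = a ∨ l = b then retract (f l) (h l) else 1)
        * kron (retractOff f h a b) := by
    rw [kron_mul_kron]
    congr 1
    funext l
    by_cases hl : l = a ∨ l = b <;> simp [retractOff, hl]
  rw [hfac, ← Matrix.mulVec_mulVec]
  by_contra hne
  obtain ⟨v, hv, hM⟩ := exists_of_kron_mulVec_ne_zero hne
  refine hv ?_
  have : v = Function.update (Function.update t a (v a)) b (v b) := by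
    funext l
    by_cases hlb : l = b
    · subst hlb; simp
    by_cases hla : l = a
    · subst hla; simp [hab]
    rw [Function.update_of_ne hlb, Function.update_of_ne hla]
    have := hM l
    rw [if_neg (by tauto)] at this
    by_contra hne
    exact this (Matrix.one_apply_ne (Ne.symm hne))
  rw [this]
  exact congrFun (congrFun h0 (v a)) (v b)

/-- A path of chains of degree two that starts at zero, changes one coefficient at a time and has
boundaries of small weight cannot end at a cycle that is not a boundary. -/
theorem exists_boundary_of_path (H : ∀ l, GradedInverse (f l) (h l) (ε l))
    (hf : kronSum f * kronSum f = 0) {d : ℕ} (hd : 2 ≤ d)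
    (hdist : ∀ l, ∀ x ∈ lowKernel (f l) (ε l), x ≠ 0 → d ≤ hammingNorm x) {N : ℕ}
    (z : Fin (N + 1) → Cube n r → ZMod 2) (hz : ∀ k s, z k s ≠ 0 → gradedDegree ε s = 2)
    (h0 : z 0 = 0) (henergy : ∀ k, hammingNorm (kronSum f *ᵥ z k) < d)
    (hstep : ∀ (k : Fin N) s s', z k.succ s ≠ z k.castSucc s → z k.succ s' ≠ z k.castSucc s' →
      s = s')
    (hlast : kronSum f *ᵥ z (Fin.last N) = 0) : ∃ w, z (Fin.last N) = kronSum f *ᵥ w := by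
  refine exists_boundary_of_kron_retract_eq_zero (h := h) hf hlast (funext fun t => ?_)
  by_contra hne
  obtain ⟨v, hv, hM⟩ := exists_of_kron_mulVec_ne_zero hne
  have htdeg : gradedDegree ε t = 2 := by
    rw [← hz _ v hv, gradedDegree, gradedDegree]
    simp only [fun l => (H l).retract_graded _ _ (hM l)]
  have hlow : (Finset.univ.filter fun l => ε l (t l) = true)ᶜ.card = 2 := by
    rw [Finset.card_compl, show (Finset.univ.filter fun l => ε l (t l) = true).card = 2 from htdeg]
    rfl
  -- The plane is spanned by the two low directions of `t`.
  obtain ⟨a, b, hab, hset⟩ := Finset.card_eq_two.1 hlow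
  have ht : ∀ l, l ≠ a → l ≠ b → ε l (t l) = true := fun l hla hlb => by
    have : l ∉ (Finset.univ.filter fun l => ε l (t l) = true)ᶜ := by
      rw [hset]; simp [hla, hlb]
    simpa using this
  refine hne (kron_retract_eq_zero_of_slice_eq_zero hab ?_)
  refine eq_zero_of_path hd (hdist b) (hdist a)
    (fun k => slice t a b (kron (retractOff f h a b) *ᵥ z k)) ?_ (fun k => ?_) (fun k => ?_)
    fun i => ?_
  · simp only [h0, Matrix.mulVec_zero]
    rfl
  · exact (badLines_slice_le H hab ht (hz k)).trans_lt (henergy k)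
  · by_cases hq : ∃ q, z k.succ q ≠ z k.castSucc q
    · obtain ⟨q, hq⟩ := hq
      exact ⟨q a, q b, slice_update q (fun s hs => by
        by_contra hne
        exact hs (hstep k s q hne hq)) hab⟩
    · push Not at hq
      -- Nothing changes in this step, so any position serves.
      exact ⟨t a, t b, slice_update t (fun s _ => hq s) hab⟩
  · by_contra hi
    obtain ⟨v, hv, -⟩ := exists_syndrome_of_bad_row H hab ht (hz _) i hi
    exact hv (congrFun hlast v)

end Slice

/-! ### Extension by zero from a block of a basis -/

section Extend

variable {Q : Type} {p q : Q → Prop} [DecidablePred p] [DecidablePred q]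

/-- Extension by zero from a subtype. -/
def extendZero (p : Q → Prop) [DecidablePred p] (x : {s // p s} → ZMod 2) (s : Q) : ZMod 2 :=
  if h : p s then x ⟨s, h⟩ else 0

theorem extendZero_val (x : {s // p s} → ZMod 2) (s : {s // p s}) : extendZero p x s.1 = x s :=
  dif_pos s.2

theorem of_extendZero_ne_zero {x : {s // p s} → ZMod 2} {s : Q} (h : extendZero p x s ≠ 0) :
    p s := by
  by_contra hs
  exact h (dif_neg hs)

theorem extendZero_zero : extendZero p 0 = 0 := by
  funext s
  by_cases h : p s <;> simp [extendZero, h]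

variable [Fintype Q]

theorem mulVec_extendZero (K : Matrix Q Q (ZMod 2)) (hK : ∀ t s, K t s ≠ 0 → p s → q t)
    (x : {s // p s} → ZMod 2) :
    K *ᵥ extendZero p x
      = extendZero q (K.submatrix (Subtype.val : {t // q t} → Q) Subtype.val *ᵥ x) := by
  have hsum : ∀ t, (K *ᵥ extendZero p x) t = ∑ s : {s // p s}, K t s.1 * x s := fun t => by
    simp only [← extendZero_val x]
    rw [← Finset.sum_subtype (Finset.univ.filter p) (by simp)
      (fun s => K t s * extendZero p x s)]
    refine (Finset.sum_subset (Finset.subset_univ _) fun s _ hs => ?_).symm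
    rw [extendZero, dif_neg (by simpa using hs), mul_zero]
  funext t
  by_cases ht : q t
  · rw [hsum, extendZero, dif_pos ht]
    rfl
  · rw [extendZero, dif_neg ht, hsum]
    refine Finset.sum_eq_zero fun s _ => ?_
    by_contra hne
    exact ht (hK t s.1 (left_ne_zero_of_mul hne) s.2)

/-- Components of `w` outside the block `q` do not contribute to the block `p`, so a boundary in the
whole complex is one between the two degrees concerned. -/
theorem eq_submatrix_mulVec_of_extendZero_eq (K : Matrix Q Q (ZMod 2))
    (hK : ∀ t s, K t s ≠ 0 → p t → q s) {x : {s // p s} → ZMod 2} {w : Q → ZMod 2}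
    (h : extendZero p x = K *ᵥ w) :
    K.submatrix (Subtype.val : {t // p t} → Q) (Subtype.val : {s // q s} → Q)
      *ᵥ (fun s => w s.1) = x := by
  funext t
  rw [← extendZero_val x t, h]
  change ∑ s : {s // q s}, K t.1 s.1 * w s.1 = ∑ s, K t.1 s * w s
  rw [← Finset.sum_subtype (Finset.univ.filter q) (by simp) (fun s => K t.1 s * w s)]
  refine Finset.sum_subset (Finset.subset_univ _) fun s _ hs => ?_
  by_contra hne
  exact hs (Finset.mem_filter.2 ⟨Finset.mem_univ _, hK _ _ (left_ne_zero_of_mul hne) t.2⟩)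

theorem hammingNorm_extendZero (x : {s // p s} → ZMod 2) :
    hammingNorm (extendZero p x) = hammingNorm x := by
  have : (Finset.univ.filter fun s => extendZero p x s ≠ 0)
      = (Finset.univ.filter fun s => x s ≠ 0).map (Function.Embedding.subtype p) := by
    ext s
    simp only [Finset.mem_filter, Finset.mem_univ, true_and, Finset.mem_map,
      Function.Embedding.subtype_apply]
    constructor
    · intro h
      have hs := of_extendZero_ne_zero h
      exact ⟨⟨s, hs⟩, by rwa [← extendZero_val x ⟨s, hs⟩], rfl⟩
    · rintro ⟨s, hs, rfl⟩
      rwa [extendZero_val]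
  rw [hammingNorm, this, Finset.card_map]
  rfl

end Extend

/-! ### Energies and Pauli paths -/

namespace CSSCode

variable {Q SX SZ : Type} [Fintype Q] [Fintype SX] [Fintype SZ]

/-- X-type generators see only the Z part, so a path of arbitrary Pauli operators can be replaced by
its Z parts. -/
theorem hammingNorm_HX_mulVec_le_energy (C : CSSCode Q SX SZ) (P : Pauli Q) :
    hammingNorm (C.HX *ᵥ P.z) ≤ C.energy P := by
  refine Finset.card_le_card_of_injOn Sum.inl (fun s hs => ?_) Sum.inl_injective.injOn
  simpa [parityCheck, Matrix.fromBlocks_mulVec] using hs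

theorem hammingNorm_HZ_mulVec_le_energy (C : CSSCode Q SX SZ) (P : Pauli Q) :
    hammingNorm (C.HZ *ᵥ P.x) ≤ C.energy P := by
  refine Finset.card_le_card_of_injOn Sum.inr (fun s hs => ?_) Sum.inr_injective.injOn
  simpa [parityCheck, Matrix.fromBlocks_mulVec] using hs

theorem energy_le_maxEnergy (C : CSSCode Q SX SZ) {P P' : Pauli Q} (r : PauliPath P P')
    (k : Fin (r.len + 1)) : C.energy (r.op k) ≤ C.maxEnergy r :=
  Finset.le_sup (f := fun i => C.energy (r.op i)) (Finset.mem_univ k)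

end CSSCode

theorem PauliPath.eq_of_step_ne {Q : Type} [Fintype Q] {P P' : Pauli Q} (r : PauliPath P P')
    (k : Fin r.len) {s s' : Q}
    (hs : (r.op k.succ).x s ≠ (r.op k.castSucc).x s ∨ (r.op k.succ).z s ≠ (r.op k.castSucc).z s)
    (hs' : (r.op k.succ).x s' ≠ (r.op k.castSucc).x s' ∨
      (r.op k.succ).z s' ≠ (r.op k.castSucc).z s') : s = s' := by
  refine Finset.card_le_one.1 (r.local_step k) s ?_ s' ?_
  · rw [Finset.mem_filter]
    exact ⟨Finset.mem_univ _, hs.imp Ne.symm Ne.symm⟩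
  · rw [Finset.mem_filter]
    exact ⟨Finset.mem_univ _, hs'.imp Ne.symm Ne.symm⟩

theorem eq_of_extendZero_ne {Q : Type} {p : Q → Prop} [DecidablePred p] {x y : {s // p s} → ZMod 2}
    (hxy : ∀ s s', x s ≠ y s → x s' ≠ y s' → s = s') {s s' : Q}
    (hs : extendZero p x s ≠ extendZero p y s) (hs' : extendZero p x s' ≠ extendZero p y s') :
    s = s' := by
  have key : ∀ s, extendZero p x s ≠ extendZero p y s → ∃ h : p s, x ⟨s, h⟩ ≠ y ⟨s, h⟩ := by
    intro s hs
    by_cases h : p s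
    · exact ⟨h, by simpa [extendZero, h] using hs⟩
    · simp [extendZero, h] at hs
  obtain ⟨h, hne⟩ := key s hs
  obtain ⟨h', hne'⟩ := key s' hs'
  exact congrArg Subtype.val (hxy _ _ hne hne')

/-! ### The energy barrier of the product code -/

theorem distance_le {m n : ℕ} {δ : Matrix (Fin m) (Fin n) (ZMod 2)} {x : Fin n → ZMod 2}
    (hx : δ *ᵥ x = 0) (h0 : x ≠ 0) : distance δ ≤ hammingNorm x :=
  iInf_le_of_le x (iInf_le_of_le hx (iInf_le_of_le h0 le_rfl))

theorem distance_le_of_mem_lowKernel {m n : ℕ} {δ : Matrix (Fin m) (Fin n) (ZMod 2)}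
    {x : Fin n ⊕ Fin m → ZMod 2} (hx : x ∈ lowKernel (factorMap δ) Sum.isRight) (h0 : x ≠ 0) :
    distance δ ≤ hammingNorm x := by
  have hinr : ∀ j, x (Sum.inr j) = 0 := fun j => hx.1 _ rfl
  refine (distance_le (x := x ∘ Sum.inl) ?_ ?_).trans (Nat.cast_le.2
    (Finset.card_le_card_of_injOn Sum.inl (fun s hs => by simpa using hs)
      Sum.inl_injective.injOn))
  · funext i
    have := congrFun hx.2 (Sum.inr i)
    rw [factorMap, Matrix.fromBlocks_mulVec] at this
    simpa using this
  · refine fun h => h0 (funext fun i => ?_)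
    rcases i with i | i
    · exact congrFun h i
    · exact hinr i

theorem distance_le_of_mem_lowKernel_transpose {m n : ℕ} {δ : Matrix (Fin m) (Fin n) (ZMod 2)}
    {x : Fin n ⊕ Fin m → ZMod 2} (hx : x ∈ lowKernel (factorMap δ)ᵀ fun i => !i.isRight)
    (h0 : x ≠ 0) : distance δᵀ ≤ hammingNorm x := by
  have hinl : ∀ j, x (Sum.inl j) = 0 := fun j => hx.1 _ rfl
  refine (distance_le (x := x ∘ Sum.inr) ?_ ?_).trans (Nat.cast_le.2
    (Finset.card_le_card_of_injOn Sum.inr (fun s hs => by simpa using hs)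
      Sum.inr_injective.injOn))
  · funext i
    have := congrFun hx.2 (Sum.inl i)
    rw [factorMap, Matrix.fromBlocks_transpose, Matrix.fromBlocks_mulVec] at this
    simpa using this
  · refine fun h => h0 (funext fun i => ?_)
    rcases i with i | i
    · exact hinl i
    · exact congrFun h i

variable {n r : Fin 4 → ℕ} (δ : (l : Fin 4) → Matrix (Fin (r l)) (Fin (n l)) (ZMod 2))

theorem totalMap_eq_kronSum : totalMap δ = kronSum fun l => factorMap (δ l) := rfl

theorem totalMap_transpose : (totalMap δ)ᵀ = kronSum fun l => (factorMap (δ l))ᵀ := by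
  rw [totalMap, Matrix.transpose_sum, kronSum]
  refine Finset.sum_congr rfl fun l _ => ?_
  rw [partialMap, kron_transpose, onFactor]
  congr 1
  funext k
  by_cases hk : k = l
  · subst hk; simp
  · simp [Function.update_of_ne hk]

theorem degree_of_totalMap_ne_zero {t s : Cube n r} (h : totalMap δ t s ≠ 0) :
    degree t = degree s + 1 := by
  by_contra hne
  exact h (totalMap_eq_zero δ t s hne)

/-- The qubits, of degree 2, are in the middle of the transposed complex as well. -/
theorem gradedDegree_not_isRight (s : Cube n r) :
    gradedDegree (fun _ i => !i.isRight) s = 4 - degree s := by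
  have : (Finset.univ.filter fun l => (!(s l).isRight) = true)
      = (Finset.univ.filter fun l => (s l).isRight = true)ᶜ := by
    ext l; simp
  rw [gradedDegree, this, Finset.card_compl, degree]
  rfl

theorem le_zBarrier (hd : ∀ l, 2 ≤ distance (δ l)) :
    (⨅ l, distance (δ l)) ≤ (code4D δ).zBarrier := by
  refine le_iInf₂ fun L hL => le_iInf fun p => ?_
  by_contra! hlt
  choose h H using fun l => exists_gradedInverse_factorMap (δ l)
  have hmap : ∀ x : Cell n r 2 → ZMod 2, totalMap δ *ᵥ extendZero (fun s => degree s = 2) x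
      = extendZero (fun s => degree s = 3) ((code4D δ).HX *ᵥ x) := fun x =>
    mulVec_extendZero _ (fun t s hts hs => by rw [degree_of_totalMap_ne_zero δ hts, hs]) x
  have hlast : (p.op (Fin.last _)).z = L := by rw [p.end_eq]; rfl
  -- The distances may be infinite, so `d` is built from the path: it exceeds every energy on it, is
  -- at least 2, and is still at most the weight of any nonzero codeword.
  obtain ⟨w, hw⟩ := exists_boundary_of_path (d := max ((code4D δ).maxEnergy p + 1) 2) H
    (totalMap_mul_self δ) (le_max_right _ _)
    (fun l x hx h0 => max_le
      (Nat.succ_le_of_lt (Nat.cast_lt.1 (hlt.trans_le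
        ((iInf_le _ l).trans (distance_le_of_mem_lowKernel hx h0)))))
      (Nat.cast_le.1 ((hd l).trans (distance_le_of_mem_lowKernel hx h0))))
    (fun k => extendZero (fun s => degree s = 2) (p.op k).z)
    (fun k s hs => of_extendZero_ne_zero (p := fun s => degree s = 2) hs)
    (by simp only [p.start_eq]; exact extendZero_zero)
    (fun k => by
      rw [← totalMap_eq_kronSum, hmap, hammingNorm_extendZero]
      exact lt_max_of_lt_left (Nat.lt_succ_of_le
        (((code4D δ).hammingNorm_HX_mulVec_le_energy _).trans
          ((code4D δ).energy_le_maxEnergy p k))))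
    (fun k s s' hs hs' => eq_of_extendZero_ne
      (fun s s' hs hs' => p.eq_of_step_ne k (Or.inr hs) (Or.inr hs')) hs hs')
    (by rw [← totalMap_eq_kronSum, hmap, hlast, hL.1]; exact extendZero_zero)
  rw [hlast] at hw
  -- The degree 1 part of `w` exhibits `L` as a product of Z-type generators.
  exact hL.2 ⟨fun s => w s.1, eq_submatrix_mulVec_of_extendZero_eq (totalMap δ)
    (fun t s hts ht => Nat.succ_injective ((degree_of_totalMap_ne_zero δ hts).symm.trans ht)) hw⟩

theorem le_xBarrier (hd : ∀ l, 2 ≤ distance (δ l)ᵀ) :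
    (⨅ l, distance (δ l)ᵀ) ≤ (code4D δ).xBarrier := by
  refine le_iInf₂ fun L hL => le_iInf fun p => ?_
  by_contra! hlt
  choose h H using fun l => exists_gradedInverse_factorMap (δ l)
  have hdeg : ∀ t s, (totalMap δ)ᵀ t s ≠ 0 → degree s = degree t + 1 := fun t s hts => by
    rw [Matrix.transpose_apply] at hts
    exact degree_of_totalMap_ne_zero δ hts
  have hmap : ∀ x : Cell n r 2 → ZMod 2, (totalMap δ)ᵀ *ᵥ extendZero (fun s => degree s = 2) x
      = extendZero (fun s => degree s = 1) ((code4D δ).HZ *ᵥ x) := fun x =>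
    mulVec_extendZero _ (fun t s hts hs =>
      Nat.succ_injective ((hdeg t s hts).symm.trans hs)) x
  have hlast : (p.op (Fin.last _)).x = L := by rw [p.end_eq]; rfl
  obtain ⟨w, hw⟩ := exists_boundary_of_path (d := max ((code4D δ).maxEnergy p + 1) 2)
    (f := fun l => (factorMap (δ l))ᵀ)
    (h := fun l => (h l)ᵀ) (ε := fun _ i => !i.isRight) (fun l => (H l).transpose)
    (by rw [← totalMap_transpose, ← Matrix.transpose_mul, totalMap_mul_self, Matrix.transpose_zero])
    (le_max_right _ _)
    (fun l x hx h0 => max_le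
      (Nat.succ_le_of_lt (Nat.cast_lt.1 (hlt.trans_le
        ((iInf_le _ l).trans (distance_le_of_mem_lowKernel_transpose hx h0)))))
      (Nat.cast_le.1 ((hd l).trans (distance_le_of_mem_lowKernel_transpose hx h0))))
    (fun k => extendZero (fun s => degree s = 2) (p.op k).x)
    (fun k s hs => by
      have hs2 : degree s = 2 := of_extendZero_ne_zero (p := fun s => degree s = 2) hs
      rw [gradedDegree_not_isRight, hs2])
    (by simp only [p.start_eq]; exact extendZero_zero)
    (fun k => by
      rw [← totalMap_transpose, hmap, hammingNorm_extendZero]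
      exact lt_max_of_lt_left (Nat.lt_succ_of_le
        (((code4D δ).hammingNorm_HZ_mulVec_le_energy _).trans
          ((code4D δ).energy_le_maxEnergy p k))))
    (fun k s s' hs hs' => eq_of_extendZero_ne
      (fun s s' hs hs' => p.eq_of_step_ne k (Or.inl hs) (Or.inl hs')) hs hs')
    (by rw [← totalMap_transpose, hmap, hlast, hL.1]; exact extendZero_zero)
  rw [hlast, ← totalMap_transpose] at hw
  -- Here the degree 3 part of `w` selects X-type generators.
  exact hL.2 ⟨fun s => w s.1, eq_submatrix_mulVec_of_extendZero_eq (totalMap δ)ᵀ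
    (fun t s hts ht => by rw [hdeg t s hts, ht]) hw⟩

end HGP

theorem theorem2 (n r : Fin 4 → ℕ)
    (δ : (l : Fin 4) → Matrix (Fin (r l)) (Fin (n l)) (ZMod 2))
    (w_c w_q : ℕ)
    (hw_c : (HGP.code4D δ).maxCheckWeight = w_c)
    (hw_q : (HGP.code4D δ).maxQubitDegree = w_q)
    (hd : ∀ l, ((w_c * w_q : ℕ) : ℕ∞) ≤ HGP.distance (δ l))
    (hdT : ∀ l, ((w_c * w_q : ℕ) : ℕ∞) ≤ HGP.distance (δ l)ᵀ) :
    ((∀ l, 2 ≤ HGP.distance (δ l)) →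
      (⨅ l, HGP.distance (δ l)) ≤ (HGP.code4D δ).zBarrier) ∧
    ((∀ l, 2 ≤ HGP.distance (δ l)ᵀ) →
      (⨅ l, HGP.distance (δ l)ᵀ) ≤ (HGP.code4D δ).xBarrier) := by
  exact ⟨HGP.le_zBarrier δ, HGP.le_xBarrier δ⟩
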